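/- Let $X$ be a nonempty, convex and compact subset of a (real) Hausdorff locally convex space $E$, with the topology induced from $E$, and give $X\times X$ the product topology. Let $\mathcal{C}$ be a nonempty closed subset of $X\times X$. Assume that there exists a sequence $(G_k)_{k\ge 1}$ of subsets of $X\times X$ such that: a) for each $k\ge 1$, the set $G_k^-(y)=\{x\in X:(x,y)\in G_k\}$ is open in $X$ for each $y\in X$; b) for each $k\ge 1$, the set $G_k^+(x)=\{y\in X:(x,y)\in G_k\}$ is convex and nonempty for each $x\in X$; c) $G_{k+1}\subseteq G_k$ for each $k\ge 1$; d) for every open set $G\subseteq X\times X$ with $\mathcal{C}\subseteq G$, there exists $k\ge 1$ such that $G_k\subseteq G$. Then there exists $x^*\in X$ such that $(x^*,x^*)\in\mathcal{C}$. -/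

import Mathlib

open Set

/-- The lower section `G⁻(y) = {x ∈ X : (x, y) ∈ G}` of a set `G ⊆ X × X`. -/
def lowerSection {X : Type*} (G : Set (X × X)) (y : X) : Set X :=
  {x | (x, y) ∈ G}

/-- The upper section `G⁺(x) = {y ∈ X : (x, y) ∈ G}` of a set `G ⊆ X × X`. -/
def upperSection {X : Type*} (G : Set (X × X)) (x : X) : Set X :=
  {y | (x, y) ∈ G}

/-! If `C` misses the diagonal, then the complement of the diagonal is an open neighbourhood of `C`,
since `X` is Hausdorff, so some `G k` misses the diagonal. This contradicts the Fan–Browder theorem,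
`exists_mem_diagonal_of_isOpen_lowerSection`. By compactness, finitely many lower sections cover
`X`. Pulling them back along barycentric combinations gives an open cover of a simplex, and the KKM
theorem `exists_mem_of_closed_cover_stdSimplex` applies to a closed shrinking of it. KKM is proved
combinatorially: Scarf's lemma `exists_isDominant_image_eq_univ`, a parity count, gives approximate
solutions for finite sets of test points, and compactness yields one solution for all test points at
once. -/

/-- `S` is dominant for the family of rankings `f` if no `y` is ranked strictly above the minimum
of `S` by every ranking. -/
def IsDominant {V I L : Type*} [LE L] (f : I → V → L) (S : Finset V) : Prop :=
  ∀ y, ∃ i, ∀ x ∈ S, f i y ≤ f i x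

theorem IsDominant.mono {V I L : Type*} [LE L] {f : I → V → L} {S S' : Finset V}
    (h : IsDominant f S) (hS : S' ⊆ S) : IsDominant f S' := fun y =>
  let ⟨i, hi⟩ := h y
  ⟨i, fun x hx => hi x (hS hx)⟩

/-- A surjection between finite types whose cardinalities differ by one has exactly one
nontrivial fibre, and that fibre is a pair. -/
theorem exists_pair_fibre_of_surjective {I D : Type*} [Fintype I] [Fintype D] (m : I → D)
    (hm : Function.Surjective m) (hcard : Fintype.card I = Fintype.card D + 1) :
    ∃ i j, i ≠ j ∧ ∀ a, (∃ b, b ≠ a ∧ m b = m a) ↔ a = i ∨ a = j := by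
  classical
  obtain ⟨i, j, hij, hmij⟩ := Fintype.exists_ne_map_eq_of_card_lt m (by omega)
  have hsurj : Function.Surjective (fun a : {a // a ≠ j} => m a) := by
    intro d
    obtain ⟨a, rfl⟩ := hm d
    by_cases ha : a = j
    · exact ⟨⟨i, hij⟩, by simp [ha, hmij]⟩
    · exact ⟨⟨a, ha⟩, rfl⟩
  have hinj : Function.Injective (fun a : {a // a ≠ j} => m a) := by
    refine ((Fintype.bijective_iff_surjective_and_card _).2 ⟨hsurj, ?_⟩).1
    have := Fintype.card_subtype_compl (fun a => a = j)
    simp only [Fintype.card_subtype_eq] at this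
    simp only [ne_eq]
    omega
  have hinj' : ∀ a b, a ≠ j → b ≠ j → m a = m b → a = b := fun a b ha hb h =>
    congrArg Subtype.val (@hinj ⟨a, ha⟩ ⟨b, hb⟩ h)
  refine ⟨i, j, hij, fun a => ⟨?_, ?_⟩⟩
  · rintro ⟨b, hba, hb⟩
    by_contra! h
    by_cases hbj : b = j
    · subst hbj
      exact h.1 (hinj' a i h.2 hij (by rw [hmij, hb]))
    · exact hba (hinj' b a hbj h.2 hb)
  · rintro (rfl | rfl)
    exacts [⟨j, hij.symm, hmij.symm⟩, ⟨i, hij, hmij⟩]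

/-! ### Scarf's lemma: doors, rooms and parity -/

section Scarf

variable {V I L : Type*} [LinearOrder L]

/-- The elements ranked above the minimum of `d` by every ranking other than the `i`-th. -/
def aboveExcept (f : I → V → L) (d : Finset V) (i : I) : Set V :=
  {y | ∀ k, k ≠ i → ∃ x ∈ d, f k x < f k y}

/-- The ranking `i` is redundant for `d` if every element of `d` is the minimum of `d` for some
ranking other than the `i`-th. -/
def IsRedundant (f : I → V → L) (d : Finset V) (i : I) : Prop :=
  ∀ x ∈ d, ∃ k, k ≠ i ∧ ∀ x' ∈ d, f k x ≤ f k x'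

/-- `y` is the `i`-th best element of `aboveExcept f d i`. -/
def IsBest (f : I → V → L) (d : Finset V) (i : I) (y : V) : Prop :=
  y ∈ aboveExcept f d i ∧ ∀ w ∈ aboveExcept f d i, f i w ≤ f i y

theorem IsDominant.le_of_mem_aboveExcept {f : I → V → L} {d : Finset V} (hd : IsDominant f d)
    {i : I} {y : V} (hy : y ∈ aboveExcept f d i) : ∀ x ∈ d, f i y ≤ f i x := by
  obtain ⟨k, hk⟩ := hd y
  by_cases hki : k = i
  · exact hki ▸ hk
  · obtain ⟨x, hx, hlt⟩ := hy k hki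
    exact absurd (hk x hx) hlt.not_ge

theorem IsRedundant.notMem {f : I → V → L} {d : Finset V} {i : I} (hi : IsRedundant f d i)
    {y : V} (hy : y ∈ aboveExcept f d i) : y ∉ d := by
  intro hyd
  obtain ⟨k, hk, hmin⟩ := hi y hyd
  obtain ⟨x, hx, hlt⟩ := hy k hk
  exact absurd (hmin x hx) hlt.not_ge

theorem IsDominant.ne_of_mem_aboveExcept {f : I → V → L} {d : Finset V} (hd : IsDominant f d)
    {i j : I} (hij : i ≠ j) {y z : V} (hy : y ∈ aboveExcept f d i)
    (hz : z ∈ aboveExcept f d j) : y ≠ z := by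
  rintro rfl
  obtain ⟨x, hx, hlt⟩ := hz i hij
  exact absurd (hd.le_of_mem_aboveExcept hy x hx) hlt.not_ge

theorem IsDominant.insert_of_isBest [DecidableEq V] {f : I → V → L} {d : Finset V}
    (hd : IsDominant f d) {i : I} {y : V} (hy : IsBest f d i y) :
    IsDominant f (insert y d) := by
  intro w
  by_cases hw : w ∈ aboveExcept f d i
  · refine ⟨i, fun x hx => ?_⟩
    rcases Finset.mem_insert.1 hx with rfl | hx
    · exact hy.2 w hw
    · exact (hy.2 w hw).trans (hd.le_of_mem_aboveExcept hy.1 x hx)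
  · simp only [aboveExcept, Set.mem_ofPred_eq, not_forall, not_exists, not_and, not_lt] at hw
    obtain ⟨k, hk, hle⟩ := hw
    refine ⟨k, fun x hx => ?_⟩
    rcases Finset.mem_insert.1 hx with rfl | hx
    · obtain ⟨x, hx, hlt⟩ := hy.1 k hk
      exact (hle x hx).trans hlt.le
    · exact hle x hx

variable [Fintype I]

/-- Each element of the room is its minimum for some ranking, and equal cardinalities make this a
bijection with the rankings. The index `i` is the ranking matched to `y`; all the others have their
minimum in `d`. -/
theorem IsDominant.exists_isBest_of_insert [DecidableEq V] {f : I → V → L}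
    (hf : ∀ i, Function.Injective (f i)) {d : Finset V} {y : V} (hyd : y ∉ d)
    (hcard : d.card + 1 = Fintype.card I) (hS : IsDominant f (insert y d)) :
    ∃ i, IsRedundant f d i ∧ IsBest f d i y := by
  have hex : ∀ x : (insert y d : Finset V), ∃ i, ∀ x' ∈ insert y d, f i x ≤ f i x' :=
    fun x => hS x
  choose m hm using hex
  have hinj : Function.Injective m := by
    intro x x' h
    refine Subtype.ext (hf (m x) (le_antisymm (hm x x' x'.2) ?_))
    rw [h]
    exact hm x' x x.2
  have hbij : Function.Bijective m := by
    rw [Fintype.bijective_iff_injective_and_card]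
    refine ⟨hinj, ?_⟩
    rw [Fintype.card_coe, Finset.card_insert_of_notMem hyd, hcard]
  have hys : y ∈ insert y d := Finset.mem_insert_self y d
  have hy : y ∈ aboveExcept f d (m ⟨y, hys⟩) := by
    intro k hk
    obtain ⟨x, rfl⟩ := hbij.2 k
    have hxy : (x : V) ≠ y := fun h => hk (congrArg m (Subtype.ext h))
    exact ⟨x, (Finset.mem_insert.1 x.2).resolve_left hxy,
      lt_of_le_of_ne (hm x y hys) fun h => hxy (hf _ h)⟩
  refine ⟨m ⟨y, hys⟩, ?_, hy, ?_⟩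
  · intro x hx
    have hxs : x ∈ insert y d := Finset.mem_insert_of_mem hx
    refine ⟨m ⟨x, hxs⟩, fun h => hyd ?_, fun x' hx' => hm _ x' (Finset.mem_insert_of_mem hx')⟩
    have : x = y := congrArg Subtype.val (hinj h)
    exact this ▸ hx
  · intro w hw
    obtain ⟨k, hk⟩ := hS w
    by_cases hki : k = m ⟨y, hys⟩
    · exact hki ▸ hk y hys
    · obtain ⟨x, hx, hlt⟩ := hw k hki
      exact absurd (hk x (Finset.mem_insert_of_mem hx)) hlt.not_ge

/-- Send each ranking to the minimum of `d` for it. By dominance this is onto `d`, and a ranking is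
redundant exactly when it shares its minimum with another one. -/
theorem IsDominant.exists_redundant_pair {f : I → V → L} (hf : ∀ i, Function.Injective (f i))
    {d : Finset V} (hd : IsDominant f d) (hne : d.Nonempty)
    (hcard : d.card + 1 = Fintype.card I) :
    ∃ i j, i ≠ j ∧ ∀ a, IsRedundant f d a ↔ a = i ∨ a = j := by
  choose m hmd hm using fun i => d.exists_min_image (f i) hne
  have hmin : ∀ k x, x ∈ d → (∀ x' ∈ d, f k x ≤ f k x') → m k = x := fun k x hx h =>
    hf k (le_antisymm (hm k x hx) (h _ (hmd k)))
  obtain ⟨i, j, hij, h⟩ := exists_pair_fibre_of_surjective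
    (fun i => (⟨m i, hmd i⟩ : d)) (by
      rintro ⟨x, hx⟩
      obtain ⟨k, hk⟩ := hd x
      exact ⟨k, Subtype.ext (hmin k x hx hk)⟩) (by rw [Fintype.card_coe, hcard])
  refine ⟨i, j, hij, fun a => (Iff.trans ⟨fun ha => ?_, ?_⟩ (h a))⟩
  · obtain ⟨k, hk, hle⟩ := ha (m a) (hmd a)
    exact ⟨k, hk, Subtype.ext (hmin k _ (hmd a) hle)⟩
  · rintro ⟨b, hba, hb⟩ x hx
    obtain ⟨k, hk⟩ := hd x
    by_cases hka : k = a
    · refine ⟨b, hba, ?_⟩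
      have : m b = x := (congrArg Subtype.val hb).trans (hka ▸ hmin k x hx hk)
      exact this ▸ hm b
    · exact ⟨k, hka, hk⟩

omit [Fintype I] in
theorem exists_isBest [Finite V] {f : I → V → L} {d : Finset V} {i : I}
    (h : (aboveExcept f d i).Nonempty) : ∃ y, IsBest f d i y :=
  (aboveExcept f d i).toFinite.exists_maximalFor (f i) _ h |>.imp fun y hy =>
    ⟨hy.1, fun w hw => (le_total (f i w) (f i y)).elim id fun h => hy.2 hw h⟩

variable [Fintype V]

open Classical in
/-- Dominant sets with as many elements as there are rankings. -/
noncomputable def rooms (f : I → V → L) : Finset (Finset V) :=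
  Finset.univ.filter fun S => S.card = Fintype.card I ∧ IsDominant f S

open Classical in
/-- Dominant sets with one element fewer than there are rankings, whose elements have all the
colours but `i₀`. -/
noncomputable def doors [DecidableEq I] (f : I → V → L) (c : V → I) (i₀ : I) : Finset (Finset V) :=
  Finset.univ.filter fun d =>
    d.card + 1 = Fintype.card I ∧ IsDominant f d ∧ d.image c = Finset.univ.erase i₀

theorem mem_rooms {f : I → V → L} {S : Finset V} :
    S ∈ rooms f ↔ S.card = Fintype.card I ∧ IsDominant f S := by
  classical simp [rooms]

theorem mem_doors [DecidableEq I] {f : I → V → L} {c : V → I} {i₀ : I} {d : Finset V} :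
    d ∈ doors f c i₀ ↔
      d.card + 1 = Fintype.card I ∧ IsDominant f d ∧ d.image c = Finset.univ.erase i₀ := by
  classical simp [doors]

variable [DecidableEq V] [DecidableEq I]

/-- If the room contains a door, exactly one colour is repeated, on two elements; the doors are
obtained by deleting either of them. -/
theorem even_card_doors_of_not_colourful {f : I → V → L} {c : V → I} {i₀ : I} {S : Finset V}
    (hS : S ∈ rooms f) (hcol : S.image c ≠ Finset.univ) :
    Even ((doors f c i₀).filter (· ⊆ S)).card := by
  rw [mem_rooms] at hS
  obtain ⟨hcard, hdom⟩ := hS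
  rcases Finset.eq_empty_or_nonempty ((doors f c i₀).filter (· ⊆ S)) with h | ⟨d, hd⟩
  · simp [h]
  rw [Finset.mem_filter, mem_doors] at hd
  obtain ⟨⟨hdcard, -, hdc⟩, hdS⟩ := hd
  obtain ⟨x, hxd, rfl⟩ : ∃ x, x ∉ d ∧ insert x d = S :=
    (Finset.covBy_iff_exists_insert.1 (Finset.covBy_iff_card_sdiff_eq_one.2
      ⟨hdS, by rw [Finset.card_sdiff_of_subset hdS]; omega⟩))
  have hinj : Set.InjOn c d := by
    rw [← Finset.card_image_iff, hdc, Finset.card_erase_of_mem (Finset.mem_univ _),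
      Finset.card_univ]
    omega
  have hcx : c x ∈ d.image c := by
    rw [hdc]
    refine Finset.mem_erase.2 ⟨fun h => hcol ?_, Finset.mem_univ _⟩
    rw [Finset.image_insert, hdc, h, Finset.insert_erase (Finset.mem_univ _)]
  obtain ⟨x', hx', hcx'⟩ := Finset.mem_image.1 hcx
  have hne : x ≠ x' := fun h => hxd (h ▸ hx')
  suffices h : (doors f c i₀).filter (· ⊆ insert x d) = {d, (insert x d).erase x'} by
    rw [h, Finset.card_pair]
    · exact even_two
    · intro h
      exact (Finset.notMem_erase x' (insert x d)) (h ▸ hx')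
  ext d'
  rw [Finset.mem_filter, mem_doors, Finset.mem_insert, Finset.mem_singleton]
  constructor
  · rintro ⟨⟨hc', -, hi'⟩, hs'⟩
    have hinj' : Set.InjOn c d' := by
      rw [← Finset.card_image_iff, hi', Finset.card_erase_of_mem (Finset.mem_univ _),
        Finset.card_univ]
      omega
    by_cases hx : x ∈ d'
    · right
      refine Finset.eq_of_subset_of_card_le (fun z hz => Finset.mem_erase.2 ⟨?_, hs' hz⟩) ?_
      · rintro rfl
        exact hne (hinj' hx hz hcx'.symm)
      · rw [Finset.card_erase_of_mem (Finset.mem_insert_of_mem hx')]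
        omega
    · left
      refine Finset.eq_of_subset_of_card_le (fun z hz => ?_) (by omega)
      exact (Finset.mem_insert.1 (hs' hz)).resolve_left fun h => hx (h ▸ hz)
  · rintro (rfl | rfl)
    · exact ⟨⟨hdcard, hdom.mono hdS, hdc⟩, hdS⟩
    · refine ⟨⟨?_, hdom.mono (Finset.erase_subset _ _), ?_⟩, Finset.erase_subset _ _⟩
      · rw [Finset.card_erase_of_mem (Finset.mem_insert_of_mem hx')]
        omega
      · rw [← hdc]
        ext a
        simp only [Finset.mem_image, Finset.mem_erase, Finset.mem_insert]
        constructor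
        · rintro ⟨z, ⟨hz, rfl | hzd⟩, rfl⟩
          exacts [⟨x', hx', hcx'⟩, ⟨z, hzd, rfl⟩]
        · rintro ⟨z, hz, rfl⟩
          by_cases hzx : z = x'
          · exact ⟨x, ⟨hne, Or.inl rfl⟩, by rw [hzx, hcx']⟩
          · exact ⟨z, ⟨hzx, Or.inr hz⟩, rfl⟩

-- A room through `d` adds the best element for a redundant ranking, and different rankings add
-- different elements. The set `P` lets one count serve both interior and boundary doors.
omit [DecidableEq I] in
theorem card_filter_rooms_of_isBest {f : I → V → L} (hf : ∀ i, Function.Injective (f i))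
    {d : Finset V} (hd : IsDominant f d) (hcard : d.card + 1 = Fintype.card I)
    (P : Finset I) (Y : I → V) (hP : ∀ i ∈ P, IsRedundant f d i ∧ IsBest f d i (Y i))
    (hP' : ∀ i, IsRedundant f d i → (aboveExcept f d i).Nonempty → i ∈ P) :
    ((rooms f).filter (d ⊆ ·)).card = P.card := by
  suffices h : (rooms f).filter (d ⊆ ·) = P.image fun i => insert (Y i) d by
    rw [h, Finset.card_image_of_injOn]
    intro i hi j hj hij
    by_contra hne
    have hYi := (hP i hi).1.notMem (hP i hi).2.1
    have : Y i ∈ insert (Y j) d := by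
      have h := Finset.mem_insert_self (Y i) d
      rwa [show insert (Y i) d = insert (Y j) d from hij] at h
    exact hd.ne_of_mem_aboveExcept hne (hP i hi).2.1 (hP j hj).2.1
      ((Finset.mem_insert.1 this).resolve_right hYi)
  ext S
  rw [Finset.mem_filter, mem_rooms, Finset.mem_image]
  constructor
  · rintro ⟨⟨hScard, hS⟩, hdS⟩
    obtain ⟨y, hyd, rfl⟩ : ∃ x, x ∉ d ∧ insert x d = S :=
      (Finset.covBy_iff_exists_insert.1 (Finset.covBy_iff_card_sdiff_eq_one.2
        ⟨hdS, by rw [Finset.card_sdiff_of_subset hdS]; omega⟩))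
    obtain ⟨i, hi, hbest⟩ := hS.exists_isBest_of_insert hf hyd hcard
    have hiP := hP' i hi ⟨y, hbest.1⟩
    refine ⟨i, hiP, ?_⟩
    rw [hf i (le_antisymm (hbest.2 _ (hP i hiP).2.1) ((hP i hiP).2.2 _ hbest.1))]
  · rintro ⟨i, hi, rfl⟩
    obtain ⟨hred, hbest⟩ := hP i hi
    refine ⟨⟨?_, hd.insert_of_isBest hbest⟩, Finset.subset_insert _ _⟩
    rw [Finset.card_insert_of_notMem (hred.notMem hbest.1), hcard]

/-- **Scarf's lemma**: for rankings with slack elements `e i`, every colouring which is standard on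
the slack elements admits a dominant set bearing all the colours. -/
theorem exists_isDominant_image_eq_univ [Nonempty I] {f : I → V → L}
    (hf : ∀ i, Function.Injective (f i)) {e : I → V} (hmin : ∀ i v, f i (e i) ≤ f i v)
    (hbig : ∀ i k, k ≠ i → ∀ v, v ∉ Set.range e → f i v < f i (e k))
    (hne : ∃ v, v ∉ Set.range e) {c : V → I} (hc : ∀ i, c (e i) = i) :
    ∃ S : Finset V, IsDominant f S ∧ S.image c = Finset.univ := by
  by_contra! hcon
  obtain ⟨i₀⟩ := ‹Nonempty I›
  have he : Function.Injective e := fun i j h => by rw [← hc i, h, hc j]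
  -- The only door made of slack elements alone. It lies in one room and every other door in two, so
  -- the number of incidences is odd.
  set d₀ : Finset V := (Finset.univ.erase i₀).image e with hd₀
  have hmem₀ : ∀ x, x ∈ d₀ ↔ ∃ k, k ≠ i₀ ∧ e k = x := by simp [hd₀]
  have hd₀door : d₀ ∈ doors f c i₀ := by
    rw [mem_doors]
    refine ⟨?_, ?_, ?_⟩
    · rw [hd₀, Finset.card_image_of_injective _ he, Finset.card_erase_add_one (Finset.mem_univ _),
        Finset.card_univ]
    · intro y
      by_cases hy : y ∈ Set.range e
      · obtain ⟨i, rfl⟩ := hy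
        exact ⟨i, fun x _ => hmin i x⟩
      · refine ⟨i₀, fun x hx => ?_⟩
        obtain ⟨k, hk, rfl⟩ := (hmem₀ x).1 hx
        exact (hbig i₀ k hk y hy).le
    · rw [hd₀, Finset.image_image, show c ∘ e = id from funext hc, Finset.image_id]
  have hdoor : ∀ d ∈ doors f c i₀, d ≠ d₀ → ((rooms f).filter (d ⊆ ·)).card = 2 := by
    intro d hd hdne
    rw [mem_doors] at hd
    obtain ⟨hcard, hdom, him⟩ := hd
    obtain ⟨v, hvd, hv⟩ : ∃ v ∈ d, v ∉ Set.range e := by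
      by_contra! h
      refine hdne (Finset.ext fun x => ?_)
      rw [hmem₀]
      constructor
      · intro hx
        obtain ⟨k, rfl⟩ := h x hx
        have := Finset.mem_image_of_mem c hx
        rw [him, hc] at this
        exact ⟨k, Finset.ne_of_mem_erase this, rfl⟩
      · rintro ⟨k, hk, rfl⟩
        have : k ∈ d.image c := him ▸ Finset.mem_erase.2 ⟨hk, Finset.mem_univ _⟩
        obtain ⟨x, hx, hxk⟩ := Finset.mem_image.1 this
        obtain ⟨l, rfl⟩ := h x hx
        rw [hc] at hxk
        exact hxk ▸ hx
    -- The slack element `e i` beats the non-slack `v` in every ranking but the `i`-th.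
    have hab : ∀ i, (aboveExcept f d i).Nonempty := fun i =>
      ⟨e i, fun k hk => ⟨v, hvd, hbig k i hk.symm v hv⟩⟩
    choose Y hY using fun i => exists_isBest (hab i)
    obtain ⟨i, j, hij, hred⟩ := hdom.exists_redundant_pair hf ⟨v, hvd⟩ hcard
    rw [card_filter_rooms_of_isBest hf hdom hcard {i, j} Y, Finset.card_pair hij]
    · intro k hk
      exact ⟨(hred k).2 (by simpa using hk), hY k⟩
    · intro k hk _
      simpa using (hred k).1 hk
  have hdoor₀ : ((rooms f).filter (d₀ ⊆ ·)).card = 1 := by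
    obtain ⟨hcard, hdom, him⟩ := mem_doors.1 hd₀door
    obtain ⟨v, hv⟩ := hne
    have hvv : ∀ k, f k (e k) < f k v := fun k =>
      lt_of_le_of_ne (hmin k v) fun h => hv ⟨k, hf k h⟩
    obtain ⟨y, hy⟩ : ∃ y, IsBest f d₀ i₀ y :=
      exists_isBest ⟨v, fun k hk => ⟨e k, (hmem₀ _).2 ⟨k, hk, rfl⟩, hvv k⟩⟩
    rw [card_filter_rooms_of_isBest hf hdom hcard {i₀} (fun _ => y), Finset.card_singleton]
    · intro k hk
      rw [Finset.mem_singleton.1 hk]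
      refine ⟨fun x hx => ?_, hy⟩
      obtain ⟨k, hk, rfl⟩ := (hmem₀ x).1 hx
      exact ⟨k, hk, fun x' _ => hmin k x'⟩
    -- Ranking `i₀` forces `z` to be slack, and the other rankings then leave only `e j`, which
    -- contradicts the redundancy of `j`.
    · rintro j hj ⟨z, hz⟩
      by_contra hji
      rw [Finset.mem_singleton] at hji
      obtain ⟨x, hx, hlt⟩ := hz i₀ (Ne.symm hji)
      obtain ⟨k, hk, rfl⟩ := (hmem₀ x).1 hx
      by_cases hzr : z ∈ Set.range e
      · obtain ⟨l, rfl⟩ := hzr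
        by_cases hlj : l = j
        · subst hlj
          obtain ⟨k', hk', hle⟩ := hj (e l) ((hmem₀ _).2 ⟨l, hji, rfl⟩)
          by_cases hki : k' = i₀
          · subst hki
            exact absurd (hle _ hx) hlt.not_ge
          · have h := hle (e k') ((hmem₀ _).2 ⟨k', hki, rfl⟩)
            exact hk' (he (hf k' (le_antisymm (hmin k' _) h)))
        · obtain ⟨x, -, hlt⟩ := hz l hlj
          exact absurd (hmin l x) hlt.not_ge
      · exact absurd (hbig i₀ k hk z hzr) hlt.not_gt
  have hsum := Finset.sum_card_bipartiteAbove_eq_sum_card_bipartiteBelow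
    (s := doors f c i₀) (t := rooms f) (fun d S => d ⊆ S)
  have heven : Even (∑ S ∈ rooms f, ((doors f c i₀).filter (· ⊆ S)).card) :=
    Finset.even_sum _ fun S hS =>
      even_card_doors_of_not_colourful hS (hcon S (mem_rooms.1 hS).2)
  have hodd : Odd (∑ d ∈ doors f c i₀, ((rooms f).filter (d ⊆ ·)).card) := by
    rw [← Finset.add_sum_erase _ _ hd₀door, hdoor₀]
    refine odd_one.add_even (Finset.even_sum _ fun d hd => ?_)
    rw [hdoor d (Finset.mem_of_mem_erase hd) (Finset.ne_of_mem_erase hd)]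
    exact even_two
  refine (Nat.not_even_iff_odd.2 hodd) ?_
  simp only [Finset.bipartiteAbove, Finset.bipartiteBelow] at hsum
  rw [hsum]
  exact heven

end Scarf

/-! ### The KKM theorem -/

/-- A finite approximation of the Knaster–Kuratowski–Mazurkiewicz theorem. -/
theorem exists_dominating_points {I : Type*} [Fintype I] [Nonempty I]
    {B : I → Set (stdSimplex ℝ I)} (hcover : ∀ t, ∃ i, t ∈ B i) (u : Finset (stdSimplex ℝ I))
    (hu : u.Nonempty) :
    ∃ (C : I → Bool) (σ : I → stdSimplex ℝ I), (∀ j, C j = true → σ j ∈ B j) ∧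
      ∀ y ∈ u, ∃ i, C i = true ∧ ∀ j, C j = true → (y : I → ℝ) i ≤ (σ j : I → ℝ) i := by
  classical
  choose col hcol using hcover
  -- Coordinates of the simplex lie in `[0, 1]`; the values `-1` and `2` put slack elements strictly
  -- below and above them.
  let p : u ⊕ I → I → ℝ := Sum.elim (fun t => (t.1 : I → ℝ)) (fun k i => if i = k then -1 else 2)
  let r := Fintype.equivFin (u ⊕ I)
  -- The second lexicographic entry breaks ties, making each ranking injective.
  let f : I → u ⊕ I → ℝ ×ₗ Fin (Fintype.card (u ⊕ I)) := fun i v => toLex (p v i, r v)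
  have hf : ∀ i, Function.Injective (f i) := fun i v w h =>
    r.injective (congrArg Prod.snd (toLex.injective h))
  have hlt : ∀ i v w, p v i < p w i → f i v < f i w := fun i v w h =>
    Prod.Lex.toLex_lt_toLex.2 (Or.inl h)
  have hle : ∀ i v w, f i v ≤ f i w → p v i ≤ p w i := fun i v w h => by
    rcases Prod.Lex.toLex_le_toLex.1 h with h | h
    exacts [h.le, h.1.le]
  have hinl : ∀ i v, v ∉ Set.range (Sum.inr : I → u ⊕ I) → 0 ≤ p v i ∧ p v i ≤ 1 := by
    rintro i (t | k) hv
    · exact ⟨t.1.2.1 i, t.1.2.2 ▸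
        Finset.single_le_sum (f := (t.1 : I → ℝ)) (fun j _ => t.1.2.1 j) (Finset.mem_univ i)⟩
    · exact absurd ⟨k, rfl⟩ hv
  obtain ⟨t₀, ht₀⟩ := hu
  obtain ⟨S, hS, hSc⟩ := exists_isDominant_image_eq_univ (f := f) hf (e := Sum.inr)
    (c := Sum.elim (fun t => col t.1) id)
    (by
      rintro i (t | k)
      · refine (hlt _ _ _ ?_).le
        have := t.1.2.1 i
        simp only [p, Sum.elim_inr, Sum.elim_inl, if_true]
        exact lt_of_lt_of_le (by norm_num) this
      · by_cases hk : i = k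
        · rw [hk]
        · refine (hlt _ _ _ ?_).le
          simp only [p, Sum.elim_inr, if_true, if_neg hk]
          norm_num)
    (by
      intro i k hk v hv
      refine hlt _ _ _ (lt_of_le_of_lt (hinl i v hv).2 ?_)
      simp only [p, Sum.elim_inr, if_neg hk.symm]
      norm_num)
    ⟨Sum.inl ⟨t₀, ht₀⟩, by simp⟩ (fun _ => rfl)
  have hex : ∀ j, ∃ s : stdSimplex ℝ I, Sum.inr j ∉ S →
      s ∈ B j ∧ ∃ hs : s ∈ u, Sum.inl ⟨s, hs⟩ ∈ S := by
    intro j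
    by_cases hj : Sum.inr j ∈ S
    · exact ⟨t₀, fun h => absurd hj h⟩
    · obtain ⟨x, hx, hxj⟩ := Finset.mem_image.1 (hSc ▸ Finset.mem_univ j)
      rcases x with t | k
      · exact ⟨t.1, fun _ => ⟨hxj ▸ hcol t.1, t.2, hx⟩⟩
      · exact absurd (show k = j from hxj) fun h => hj (h ▸ hx)
  choose σ hσ using hex
  -- `C` marks the colours whose slack element is not in `S`; for these, `σ j` is a genuine point of
  -- colour `j`.
  refine ⟨fun j => decide (Sum.inr j ∉ S), σ, fun j hj => (hσ j (by simpa using hj)).1, ?_⟩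
  intro y hy
  obtain ⟨i, hi⟩ := hS (Sum.inl ⟨y, hy⟩)
  refine ⟨i, decide_eq_true fun h => ?_, fun j hj => ?_⟩
  · have h1 := hle _ _ _ (hi _ h)
    have h2 := y.2.1 i
    simp only [p, Sum.elim_inr, Sum.elim_inl, if_true] at h1
    exact absurd (h2.trans h1) (by norm_num)
  · obtain ⟨-, hs, hmem⟩ := hσ j (by simpa using hj)
    exact hle _ _ _ (hi _ hmem)

/-- A set of points of the simplex that no point of the simplex exceeds in all the coordinates
indexed by `C` consists of one point, which is supported in `C`. -/
theorem eq_and_support_of_dominating {I : Type*} [Fintype I] {C : I → Bool}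
    {σ : I → stdSimplex ℝ I}
    (h : ∀ y : stdSimplex ℝ I, ∃ i, C i = true ∧
      ∀ j, C j = true → (y : I → ℝ) i ≤ (σ j : I → ℝ) i) {j₀ : I} (hj₀ : C j₀ = true) :
    (∀ j, C j = true → σ j = σ j₀) ∧ ∀ i, C i ≠ true → (σ j₀ : I → ℝ) i = 0 := by
  classical
  set P : Finset I := Finset.univ.filter fun i => C i = true with hP
  have hPm : ∀ i, i ∈ P ↔ C i = true := by simp [hP]
  have hPne : P.Nonempty := ⟨j₀, (hPm _).2 hj₀⟩
  let a : I → ℝ := fun i => P.inf' hPne fun j => (σ j : I → ℝ) i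
  have ha : ∀ i j, C j = true → a i ≤ (σ j : I → ℝ) i := fun i j hj =>
    Finset.inf'_le _ ((hPm j).2 hj)
  have ha0 : ∀ i, 0 ≤ a i := fun i => Finset.le_inf' _ _ fun j _ => (σ j).2.1 i
  -- Otherwise spreading the deficit evenly over `C` gives a simplex point above the minimum in each
  -- of these coordinates.
  have hsum : 1 ≤ ∑ i ∈ P, a i := by
    by_contra! hlt
    have hcard : (0 : ℝ) < P.card := by exact_mod_cast hPne.card_pos
    set δ : ℝ := (1 - ∑ i ∈ P, a i) / P.card with hδ
    have hδ0 : 0 < δ := div_pos (by linarith) hcard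
    let y : I → ℝ := fun i => if C i = true then a i + δ else 0
    have hy : y ∈ stdSimplex ℝ I := by
      refine ⟨fun i => ?_, ?_⟩
      · by_cases hi : C i = true
        · simp only [y, if_pos hi]
          linarith [ha0 i]
        · simp only [y, if_neg hi, le_refl]
      · simp only [y]
        rw [← Finset.sum_filter, ← hP, Finset.sum_add_distrib, Finset.sum_const, nsmul_eq_mul, hδ,
          mul_div_cancel₀ _ hcard.ne']
        ring
    obtain ⟨i, hi, hle⟩ := h ⟨y, hy⟩
    have h1 : a i + δ ≤ a i := by
      refine Finset.le_inf' _ _ fun j hj => ?_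
      have hyi : y i = a i + δ := if_pos hi
      exact hyi ▸ hle j ((hPm j).1 hj)
    linarith
  have hle : ∀ j, C j = true → ∑ i, (if C i = true then a i else 0) = ∑ i, (σ j : I → ℝ) i ∧
      ∀ i, (if C i = true then a i else 0) = (σ j : I → ℝ) i := by
    intro j hj
    have hpt : ∀ i ∈ Finset.univ, (if C i = true then a i else 0) ≤ (σ j : I → ℝ) i := by
      intro i _
      split_ifs
      · exact ha i j hj
      · exact (σ j).2.1 i
    have heq : ∑ i, (if C i = true then a i else 0) = ∑ i, (σ j : I → ℝ) i := by
      refine le_antisymm (Finset.sum_le_sum hpt) ?_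
      rw [← Finset.sum_filter, ← hP]
      exact (σ j).2.2.le.trans hsum
    exact ⟨heq, fun i => (Finset.sum_eq_sum_iff_of_le hpt).1 heq i (Finset.mem_univ i)⟩
  refine ⟨fun j hj => Subtype.ext (funext fun i => ?_), fun i hi => ?_⟩
  · exact ((hle j hj).2 i).symm.trans ((hle j₀ hj₀).2 i)
  · rw [← (hle j₀ hj₀).2 i, if_neg hi]

/-- A **Knaster–Kuratowski–Mazurkiewicz theorem**: if closed sets `B i` cover the simplex, some
point `t` belongs to `B i` for every `i` in the support of `t`. -/
theorem exists_mem_of_closed_cover_stdSimplex {I : Type*} [Fintype I] [Nonempty I]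
    {B : I → Set (stdSimplex ℝ I)} (hB : ∀ i, IsClosed (B i)) (hcover : ∀ t, ∃ i, t ∈ B i) :
    ∃ t : stdSimplex ℝ I, ∀ i, (t : I → ℝ) i ≠ 0 → t ∈ B i := by
  classical
  obtain ⟨t₀⟩ : Nonempty (stdSimplex ℝ I) :=
    ⟨⟨_, single_mem_stdSimplex ℝ (Classical.arbitrary I)⟩⟩
  have hC : ∀ j, IsClosed {q : (I → Bool) × (I → stdSimplex ℝ I) | q.1 j = true} := fun j =>
    isClosed_eq (by fun_prop) continuous_const
  have hC' : ∀ j, IsOpen {q : (I → Bool) × (I → stdSimplex ℝ I) | q.1 j = true} := fun j =>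
    (isOpen_discrete {true}).preimage (f := fun q : (I → Bool) × (I → stdSimplex ℝ I) => q.1 j)
      (by fun_prop)
  have himp : ∀ (j : I) (Q : (I → Bool) × (I → stdSimplex ℝ I) → Prop), IsClosed {q | Q q} →
      IsClosed {q : (I → Bool) × (I → stdSimplex ℝ I) | q.1 j = true → Q q} := fun j Q hQ =>
    isClosed_imp (hC' j) hQ
  -- The solutions for a single test point `y`. They are closed in a compact space because `I →
  -- Bool` is finite and discrete.
  let K : stdSimplex ℝ I → Set ((I → Bool) × (I → stdSimplex ℝ I)) := fun y =>
    {q | (∀ j, q.1 j = true → q.2 j ∈ B j) ∧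
      ∃ i, q.1 i = true ∧ ∀ j, q.1 j = true → (y : I → ℝ) i ≤ (q.2 j : I → ℝ) i}
  have hK : ∀ y, IsClosed (K y) := by
    intro y
    have h1 : IsClosed (⋂ j, {q : (I → Bool) × (I → stdSimplex ℝ I) |
        q.1 j = true → q.2 j ∈ B j}) :=
      isClosed_iInter fun j => himp j _ ((hB j).preimage (by fun_prop))
    have h2 : IsClosed (⋃ i, {q : (I → Bool) × (I → stdSimplex ℝ I) | q.1 i = true} ∩
        ⋂ j, {q | q.1 j = true → (y : I → ℝ) i ≤ (q.2 j : I → ℝ) i}) := by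
      refine isClosed_iUnion_of_finite fun i => (hC i).inter (isClosed_iInter fun j => himp j _ ?_)
      exact isClosed_le continuous_const
        ((continuous_apply i).comp (continuous_subtype_val.comp (by fun_prop)))
    convert h1.inter h2 using 1
    ext q
    simp [K]
  have : CompactSpace (stdSimplex ℝ I) := isCompact_iff_compactSpace.1 (isCompact_stdSimplex ℝ I)
  obtain ⟨q, -, hq⟩ := isCompact_univ.inter_iInter_nonempty K hK (by
    intro u
    obtain ⟨C, σ, h1, h2⟩ := exists_dominating_points hcover (insert t₀ u) ⟨t₀, by simp⟩
    exact ⟨(C, σ), trivial, Set.mem_iInter₂.2 fun y hy =>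
      ⟨h1, h2 y (Finset.mem_insert_of_mem hy)⟩⟩)
  rw [Set.mem_iInter] at hq
  obtain ⟨j₀, hj₀, -⟩ := (hq t₀).2
  obtain ⟨heq, hsupp⟩ := eq_and_support_of_dominating (fun y => (hq y).2) hj₀
  refine ⟨q.2 j₀, fun i hi => ?_⟩
  have hi' : q.1 i = true := not_not.1 fun h => hi (hsupp i h)
  exact heq i hi' ▸ (hq t₀).1 i hi'

/-! ### The Fan–Browder theorem and the conclusion -/

/-- The **Fan–Browder fixed point theorem** for a correspondence with open lower sections and
nonempty convex values. -/
theorem exists_mem_diagonal_of_isOpen_lowerSection {E : Type*} [AddCommGroup E] [Module ℝ E]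
    [TopologicalSpace E] [IsTopologicalAddGroup E] [ContinuousSMul ℝ E] {X : Set E}
    (hne : X.Nonempty) (hconv : Convex ℝ X) (hcomp : IsCompact X) {G : Set (X × X)}
    (hopen : ∀ y : X, IsOpen (lowerSection G y))
    (hval : ∀ x : X, Convex ℝ ((fun y : X => (y : E)) '' upperSection G x) ∧
      (upperSection G x).Nonempty) :
    ∃ x : X, (x, x) ∈ G := by
  classical
  have : CompactSpace X := isCompact_iff_compactSpace.1 hcomp
  obtain ⟨s, hs⟩ := isCompact_univ.elim_finite_subcover (fun y : X => lowerSection G y) hopen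
    (fun x _ => by
      obtain ⟨y, hy⟩ := (hval x).2
      exact Set.mem_iUnion.2 ⟨y, hy⟩)
  have hs' : ∀ x : X, ∃ y : s, (x, (y : X)) ∈ G := fun x => by
    obtain ⟨y, hy, hxy⟩ := Set.mem_iUnion₂.1 (hs (Set.mem_univ x))
    exact ⟨⟨y, hy⟩, hxy⟩
  have : Nonempty s := ⟨(hs' ⟨hne.some, hne.some_mem⟩).choose⟩
  let φ : stdSimplex ℝ s → X := fun t =>
    ⟨∑ i, (t : s → ℝ) i • ((i : X) : E),
      hconv.sum_mem (fun i _ => t.2.1 i) t.2.2 fun i _ => i.1.2⟩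
  have hφ : Continuous φ := by
    refine Continuous.subtype_mk (continuous_finsetSum _ fun i _ => ?_) _
    exact ((continuous_apply i).comp continuous_subtype_val).smul continuous_const
  have : CompactSpace (stdSimplex ℝ s) := isCompact_iff_compactSpace.1 (isCompact_stdSimplex ℝ s)
  obtain ⟨B, hBcover, hBclosed, hBsub⟩ := exists_iUnion_eq_closed_subset
    (u := fun i : s => φ ⁻¹' lowerSection G i) (fun i => (hopen i).preimage hφ)
    (fun _ => Set.toFinite _)
    (Set.eq_univ_of_forall fun t => Set.mem_iUnion.2 (hs' (φ t)))
  obtain ⟨t, ht⟩ := exists_mem_of_closed_cover_stdSimplex hBclosed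
    (fun t => Set.mem_iUnion.1 (hBcover ▸ Set.mem_univ t))
  have hmem : (φ t : E) ∈ (fun y : X => (y : E)) '' upperSection G (φ t) := by
    -- `finsum_mem` requires membership only where the weight is nonzero, which is exactly what KKM
    -- provides.
    have h := (hval (φ t)).1.finsum_mem (w := (t : s → ℝ)) (z := fun i : s => ((i : X) : E))
      t.2.1 (by rw [finsum_eq_sum_of_fintype]; exact t.2.2)
      (fun i hi => ⟨i, hBsub i (ht i hi), rfl⟩)
    rwa [finsum_eq_sum_of_fintype] at h
  obtain ⟨y, hy, hyx⟩ := hmem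
  exact ⟨φ t, (Subtype.ext hyx : y = φ t) ▸ hy⟩

/-- `X` carries the topology induced from `E` and `X × X` the product topology, so that closed and
open subsets of `X × X`, and open subsets of `X`, are meant relative to `X × X` and `X`. -/
theorem theorem4 {E : Type*} [AddCommGroup E] [Module ℝ E] [TopologicalSpace E]
    [IsTopologicalAddGroup E] [ContinuousSMul ℝ E] [LocallyConvexSpace ℝ E] [T2Space E]
    (X : Set E) (hX_nonempty : X.Nonempty) (hX_convex : Convex ℝ X) (hX_compact : IsCompact X)
    (C : Set (X × X)) (hC_nonempty : C.Nonempty) (hC_closed : IsClosed C)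
    (G : ℕ+ → Set (X × X))
    (ha : ∀ k : ℕ+, ∀ y : X, IsOpen (lowerSection (G k) y))
    (hb : ∀ k : ℕ+, ∀ x : X,
      Convex ℝ ((fun y : X => (y : E)) '' upperSection (G k) x) ∧ (upperSection (G k) x).Nonempty)
    (hc : ∀ k : ℕ+, G (k + 1) ⊆ G k)
    (hd : ∀ U : Set (X × X), IsOpen U → C ⊆ U → ∃ k : ℕ+, G k ⊆ U) :
    ∃ x : X, (x, x) ∈ C := by
  by_contra! h
  obtain ⟨k, hk⟩ := hd {p | p.1 ≠ p.2} (isOpen_ne_fun continuous_fst continuous_snd) (by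
    rintro ⟨x, y⟩ hxy (rfl : x = y)
    exact h x hxy)
  obtain ⟨x, hx⟩ :=
    exists_mem_diagonal_of_isOpen_lowerSection hX_nonempty hX_convex hX_compact (ha k) (hb k)
  exact hk hx rfl
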